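/- Let $n\ge 2$, let $a_1\ge a_2\ge\dots\ge a_n\ge 0$ be real numbers, not all zero, and let $q>0$. For $x\in\mathbb R^n$ let $x_1^*\ge\dots\ge x_n^*$ be the non-increasing rearrangement of $|x_1|,\dots,|x_n|$, and let the Lorentz space $\ell_{w,q}^n$ be $\mathbb R^n$ with the norm ($q$-norm if $q<1$) $$\|x\|=\bigl(a_1(x_1^*)^q+\dots+a_n(x_n^*)^q\bigr)^{1/q}.$$ For a measure space $(\Omega,\mu)$ let $L_q(\mu)$ be the space of (classes of) real measurable functions $f$ with $\|f\|_q=\bigl(\int|f|^q\,d\mu\bigr)^{1/q}<\infty$, and let $L_q=L_q(0,1)$ with Lebesgue measure. We say that $\ell_{w,q}^n$ is isometric to a subspace of $L_q(\mu)$ if there is a linear map $T:\mathbb R^n\to L_q(\mu)$ with $\|Tx\|_q=\|x\|$ for all $x$. (a) Let $0<q\le 1$. Then $\ell_{w,q}^n$ is isometric to a subspace of $L_q$ if and only if $$a_1-a_2=a_2-a_3=\dots=a_{n-1}-a_n ,$$ and this condition is also necessary for $\ell_{w,q}^n$ to be isometric to a subspace of $L_q(\mu)$ for an arbitrary measure space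 $(\Omega,\mu)$. In particular, for $n=2$ the space $\ell_{w,q}^2$ is isometric to a subspace of $L_q$ for every choice of $a_1,a_2$. (b) Let $q>1$. Then $\ell_{w,q}^n$ is isometric to a subspace of $L_q$ if and only if $a_1=\dots=a_n$, and this condition is also necessary for $\ell_{w,q}^n$ to be isometric to a subspace of $L_q(\mu)$ for an arbitrary measure space $(\Omega,\mu)$. If $a_1=\dots=a_n=c$, then $\|x\|=c^{1/q}\bigl(\sum_{i=1}^n|x_i|^q\bigr)^{1/q}$ for all $x\in\mathbb R^n$, so that up to this constant factor $\ell_{w,q}^n=\ell_q^n$. -/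

import Mathlib

open MeasureTheory

noncomputable section

/-- The non-increasing rearrangement `x* = (x*₁, …, x*ₙ)` of the numbers `|x₁|, …, |xₙ|`
(`Tuple.sort f` is a permutation that makes `f` non-decreasing). -/
def decreasingRearrangement {n : ℕ} (x : Fin n → ℝ) : Fin n → ℝ :=
  fun k => |x (Tuple.sort (fun i => -|x i|) k)|

theorem decreasingRearrangement_antitone {n : ℕ} (x : Fin n → ℝ) :
    Antitone (decreasingRearrangement x) := by
  intro i j hij
  have h := Tuple.monotone_sort (fun i => -|x i|) hij
  simpa [decreasingRearrangement] using h

/-- The norm (`q`-norm if `q < 1`) of the `n`-dimensional Lorentz space with weights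
`a₁ ≥ … ≥ aₙ ≥ 0`: `‖x‖ = (a₁ (x*₁)^q + … + aₙ (x*ₙ)^q)^(1/q)`. -/
def lorentzNorm {n : ℕ} (a : Fin n → ℝ) (q : ℝ) (x : Fin n → ℝ) : ℝ :=
  (∑ k, a k * decreasingRearrangement x k ^ q) ^ (1 / q)

/-- The `n`-dimensional Lorentz space with weights `a` and exponent `q` is (linearly) isometric to
a subspace of the real space `L_q(μ)`. For every `q > 0` the norm on `Lp` is
`‖f‖ = (∫ |f|^q dμ)^(1/q)`. -/
def LorentzEmbedsInLq {n : ℕ} (a : Fin n → ℝ) (q : ℝ) {Ω : Type*} [MeasurableSpace Ω]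
    (μ : Measure Ω) : Prop :=
  ∃ T : (Fin n → ℝ) →ₗ[ℝ] Lp ℝ (ENNReal.ofReal q) μ, ∀ x, ‖T x‖ = lorentzNorm a q x

/-- All consecutive differences agree: `a₁ - a₂ = a₂ - a₃ = … = aₙ₋₁ - aₙ`. -/
def EqualDifferences {n : ℕ} (a : Fin n → ℝ) : Prop :=
  ∀ (i j : ℕ) (hi : i + 1 < n) (hj : j + 1 < n),
    a ⟨i, Nat.lt_of_succ_lt hi⟩ - a ⟨i + 1, hi⟩ = a ⟨j, Nat.lt_of_succ_lt hj⟩ - a ⟨j + 1, hj⟩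

end

/-!
Put `N = ‖·‖ ^ q`, where `‖·‖` is the Lorentz norm.

Necessity for `q < 2`: the function `|t| ^ q` is of negative type, hence so is `N` when the space
embeds into some `L_q(μ)`, and second differences of `N` are positive definite. On the vectors
`(z, …, z, s + u, s - u, 0, …)` with `k` entries `z` this second difference involves only the
weights `a_k, a_{k+1}` (counting from `0`) if `|z|` is large compared to `s`, and only `a_0, a_1`
if `|z|` is small. Testing positive definiteness on two long runs of integer values of `z`, one
with positive and one with negative coefficients, bounds `K` times the discrepancy of the two values
at `s = K - 1 / 2`, `u = 1 / 2` independently of `K`. That discrepancy is asymptotically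
`(q / 2) K ^ (q - 1)` times `(a_0 - a_k) - (a_1 - a_{k+1})`, which therefore vanishes.

Necessity for `1 < q`: `t ↦ ‖f + t g‖ ^ q` is differentiable in `L_q(μ)`, but `N` along
`(2, …, 2, 1 + t, 1 - t, 0, …)` is even in `t` with right derivative `q (a_k - a_{k+1})` at `0`.

Sufficiency: if the differences are equal, then `N` is a nonnegative combination of the functions
`|x_i| ^ q` and `max |x_i| |x_j| ^ q`. Since `max |x| |y| = |(x + y) / 2| + |(x - y) / 2|`, it is
enough to represent `(|u| + |v|) ^ q`, and for independent Cauchy variables `X`, `Y` the variable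
`u X + v Y` is distributed as `(|u| + |v|) X`.
-/

section Kernels

variable {E F : Type*} [AddCommGroup E] [AddCommGroup F]

/-- A function `N` on an abelian group is of negative type if the kernel `(x, y) ↦ N (x - y)` is
conditionally negative semidefinite. The `q`-th power of the norm of a subspace of `L_q` has this
property for `0 < q < 2`. Evenness of `N` is not part of the definition. -/
def IsNegativeType (N : E → ℝ) : Prop :=
  ∀ ⦃ι : Type⦄ [Fintype ι] (c : ι → ℝ) (x : ι → E), ∑ i, c i = 0 →
    ∑ i, ∑ j, c i * c j * N (x i - x j) ≤ 0

/-- A function `D` on an abelian group is positive definite if the real quadratic forms of the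
kernel `(x, y) ↦ D (x - y)` are nonnegative. Second differences of functions of negative type have
this property. Evenness of `D` is not part of the definition. -/
def IsPositiveDefinite (D : E → ℝ) : Prop :=
  ∀ ⦃ι : Type⦄ [Fintype ι] (c : ι → ℝ) (x : ι → E), 0 ≤ ∑ i, ∑ j, c i * c j * D (x i - x j)

theorem IsNegativeType.comp_addMonoidHom {N : F → ℝ} (hN : IsNegativeType N) (L : E →+ F) :
    IsNegativeType fun x => N (L x) := fun _ _ c x hc => by
  simpa only [map_sub] using hN c (fun i => L (x i)) hc

theorem IsNegativeType.isPositiveDefinite_second_difference {N : E → ℝ} (hN : IsNegativeType N)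
    (v : E) : IsPositiveDefinite fun x => N (x + v) + N (x - v) - 2 * N x := by
  intro ι _ c x
  have h := hN (Sum.elim c (-c)) (Sum.elim (fun i => x i + v) x) (by simp)
  simp only [Fintype.sum_sum_type, Sum.elim_inl, Sum.elim_inr, Pi.neg_apply,
    ← Finset.sum_add_distrib] at h
  rw [← neg_nonpos, ← Finset.sum_neg_distrib]
  refine (Finset.sum_congr rfl fun i _ => ?_).trans_le h
  rw [← Finset.sum_neg_distrib]
  refine Finset.sum_congr rfl fun j _ => ?_
  rw [add_sub_add_right_eq_sub, add_sub_right_comm, ← sub_sub]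
  ring

theorem even_second_difference {N : E → ℝ} (hN : N.Even) (v : E) :
    Function.Even fun x => N (x + v) + N (x - v) - 2 * N x := fun x => by
  beta_reduce
  rw [neg_add_eq_sub, ← neg_sub x v, hN, ← neg_add', hN, hN, add_comm (N (x - v))]

theorem IsPositiveDefinite.abs_le_apply_zero {D : E → ℝ} (hD : IsPositiveDefinite D)
    (heven : D.Even) (x : E) : |D x| ≤ D 0 := by
  have hform : ∀ ε : ℝ, 0 ≤ D 0 + ε * D x + (ε * D x + ε * ε * D 0) := fun ε => by
    simpa [heven x] using hD ![1, ε] ![0, x]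
  rw [abs_le]
  constructor
  · linarith [hform 1]
  · linarith [hform (-1)]

theorem IsPositiveDefinite.sum_sum_snd {D : E × F → ℝ} (hD : IsPositiveDefinite D) {κ : Type}
    [Fintype κ] (w : κ → ℝ) (z : κ → F) :
    IsPositiveDefinite fun s => ∑ k, ∑ l, w k * w l * D (s, z k - z l) := by
  intro ι _ c s
  refine (hD (fun m : ι × κ => c m.1 * w m.2) fun m => (s m.1, z m.2)).trans_eq ?_
  simp only [Fintype.sum_prod_type, Prod.mk_sub_mk]
  refine Finset.sum_congr rfl fun i _ => ?_
  rw [Finset.sum_comm]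
  refine Finset.sum_congr rfl fun j _ => ?_
  rw [Finset.mul_sum]
  refine Finset.sum_congr rfl fun k _ => ?_
  rw [Finset.mul_sum]
  exact Finset.sum_congr rfl fun l _ => by ring

/-- Two runs of `K` consecutive integers, `0, …, K - 1` and `2 * K, …, 3 * K - 1`. Distances
within a run are less than `K`, distances between the runs are greater than `K`. -/
def twoRuns (K : ℕ) (m : Bool × Fin K) : ℝ := m.2 + if m.1 then 2 * (K : ℝ) else 0

/-- The sign distinguishing the two runs of `twoRuns`. -/
def runSign (b : Bool) : ℝ := if b then 1 else -1

theorem sum_sum_runSign_mul_apply_twoRuns_sub {K : ℕ} {g : ℝ → ℝ} {β γ : ℝ}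
    (hnear : ∀ t : ℝ, 1 ≤ |t| → |t| ≤ K - 1 → g t = β) (hfar : ∀ t : ℝ, K ≤ |t| → g t = γ) :
    ∑ m, ∑ m', runSign m.1 * runSign m'.1 * g (twoRuns K m - twoRuns K m') =
      2 * K * (g 0 + (K - 1) * β - K * γ) := by
  have hmem : ∀ i : Fin K, (0 : ℝ) ≤ i ∧ (i : ℝ) ≤ K - 1 := fun i =>
    ⟨Nat.cast_nonneg _, le_sub_iff_add_le.2 (by exact_mod_cast i.isLt)⟩
  have hsame : ∀ b i j, g (twoRuns K (b, i) - twoRuns K (b, j)) =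
      (if j = i then g 0 - β else 0) + β := by
    intro b i j
    split_ifs with hij
    · rw [hij, sub_self, sub_add_cancel]
    · have hone : (1 : ℤ) ≤ |((i : ℕ) : ℤ) - (j : ℕ)| :=
        Int.one_le_abs (sub_ne_zero.2 (by simpa [Fin.ext_iff, eq_comm] using hij))
      rw [twoRuns, twoRuns, add_sub_add_right_eq_sub, zero_add]
      refine hnear _ (by exact_mod_cast hone) (abs_le.2 ?_)
      constructor <;> linarith [hmem i, hmem j]
  have hdiff : ∀ b i j, g (twoRuns K (b, i) - twoRuns K (!b, j)) = γ := by
    intro b i j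
    have := hmem i
    have := hmem j
    cases b
    · refine hfar _ (le_abs'.2 (Or.inl ?_))
      simp only [twoRuns, Bool.not_false, Bool.false_eq_true, if_false, if_true]
      linarith
    · refine hfar _ (le_abs'.2 (Or.inr ?_))
      simp only [twoRuns, Bool.not_true, Bool.false_eq_true, if_false, if_true]
      linarith
  have hrow : ∀ m : Bool × Fin K,
      ∑ m', runSign m.1 * runSign m'.1 * g (twoRuns K m - twoRuns K m') =
        g 0 + (K - 1) * β - K * γ := by
    rintro ⟨b, i⟩
    have hb : ∑ m', runSign b * runSign m'.1 * g (twoRuns K (b, i) - twoRuns K m') =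
        ∑ j, g (twoRuns K (b, i) - twoRuns K (b, j)) -
          ∑ j, g (twoRuns K (b, i) - twoRuns K (!b, j)) := by
      cases b <;> simp [Fintype.sum_prod_type, runSign, neg_add_eq_sub, sub_eq_add_neg]
    simp only [hb, hsame, hdiff, Finset.sum_add_distrib, Finset.sum_ite_eq', Finset.mem_univ,
      if_true, Finset.sum_const, Finset.card_univ, Fintype.card_fin, nsmul_eq_mul]
    ring
  simp only [hrow, Finset.sum_const, Finset.card_univ, Fintype.card_prod, Fintype.card_bool,
    Fintype.card_fin, nsmul_eq_mul, Nat.cast_mul, Nat.cast_ofNat]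

theorem IsPositiveDefinite.mul_abs_sub_le {D : ℝ × ℝ → ℝ} (hD : IsPositiveDefinite D)
    (heven : D.Even) {K : ℕ} (hK : 0 < K) {S d p₁ p₂ : ℝ} (hzero : ∀ z : ℝ, 1 ≤ |z| → D (0, z) = d)
    (hnear : ∀ z : ℝ, |z| ≤ K - 1 → D (S, z) = p₁) (hfar : ∀ z : ℝ, K ≤ |z| → D (S, z) = p₂) :
    K * |p₁ - p₂| ≤ D 0 - d := by
  let G : ℝ → ℝ := fun s =>
    ∑ m, ∑ m', runSign m.1 * runSign m'.1 * D (s, twoRuns K m - twoRuns K m')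
  have hG : |G S| ≤ G 0 := by
    refine (hD.sum_sum_snd _ _).abs_le_apply_zero (fun s => ?_) S
    beta_reduce
    rw [Finset.sum_comm]
    refine Finset.sum_congr rfl fun m _ => Finset.sum_congr rfl fun m' _ => ?_
    rw [← heven, Prod.neg_mk, neg_neg, neg_sub, mul_comm (runSign _)]
  have hK1 : (1 : ℝ) ≤ K := by exact_mod_cast hK
  have hS : G S = 2 * K * (K * (p₁ - p₂)) := by
    refine (sum_sum_runSign_mul_apply_twoRuns_sub (g := fun z => D (S, z))
      (fun z _ => hnear z) hfar).trans ?_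
    rw [hnear 0 (by simpa using hK1)]
    ring
  have h0 : G 0 = 2 * K * (D 0 - d) := by
    refine (sum_sum_runSign_mul_apply_twoRuns_sub (g := fun z => D (0, z))
      (fun z hz _ => hzero z hz) fun z hz => hzero z (hK1.trans hz)).trans ?_
    rw [Prod.mk_zero_zero]
    ring
  have hK2 : (0 : ℝ) < 2 * K := by positivity
  rw [hS, h0, abs_mul, abs_of_pos hK2, abs_mul, abs_of_nonneg (Nat.cast_nonneg K)] at hG
  exact le_of_mul_le_mul_left hG hK2

end Kernels

section NegativeType

theorem integrableOn_one_sub_cos_mul_rpow {q : ℝ} (hq : 0 < q) (hq2 : q < 2) (y : ℝ) :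
    IntegrableOn (fun t : ℝ => (1 - Real.cos (t * y)) * t ^ (-1 - q)) (Set.Ioi 0) := by
  have hmeas : Measurable fun t : ℝ => (1 - Real.cos (t * y)) * t ^ (-1 - q) := by fun_prop
  rw [← Set.Ioc_union_Ioi_eq_Ioi zero_le_one]
  refine IntegrableOn.union ?_ ?_
  · have hdom := (intervalIntegral.intervalIntegrable_rpow' (a := 0) (b := 1)
      (show -1 < 1 - q by linarith)).1.const_mul (y ^ 2 / 2)
    refine Integrable.mono' hdom hmeas.aestronglyMeasurable ?_
    filter_upwards [ae_restrict_mem measurableSet_Ioc] with t ht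
    have hcos := Real.one_sub_sq_div_two_le_cos (x := t * y)
    have hcos_le := Real.cos_le_one (t * y)
    have hpow : t ^ (1 - q) = t ^ 2 * t ^ (-1 - q) := by
      rw [← Real.rpow_natCast, ← Real.rpow_add ht.1]
      congr 1
      push_cast
      ring
    have hnonneg : 0 ≤ t ^ (-1 - q) := Real.rpow_nonneg ht.1.le _
    rw [Real.norm_of_nonneg (mul_nonneg (by linarith) hnonneg), hpow, ← mul_assoc]
    exact mul_le_mul_of_nonneg_right (by nlinarith) hnonneg
  · have hdom := (integrableOn_Ioi_rpow_of_lt (show -1 - q < -1 by linarith)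
      zero_lt_one).const_mul 2
    refine Integrable.mono' hdom hmeas.aestronglyMeasurable ?_
    filter_upwards [ae_restrict_mem measurableSet_Ioi] with t ht
    have hcos := Real.neg_one_le_cos (t * y)
    have hcos_le := Real.cos_le_one (t * y)
    have hnonneg : 0 ≤ t ^ (-1 - q) := Real.rpow_nonneg (zero_le_one.trans (Set.mem_Ioi.1 ht).le) _
    rw [Real.norm_of_nonneg (mul_nonneg (by linarith) hnonneg)]
    exact mul_le_mul_of_nonneg_right (by linarith) hnonneg

theorem integral_one_sub_cos_mul_rpow {q : ℝ} (hq : 0 < q) (y : ℝ) :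
    ∫ t in Set.Ioi (0 : ℝ), (1 - Real.cos (t * y)) * t ^ (-1 - q) =
      (∫ t in Set.Ioi (0 : ℝ), (1 - Real.cos t) * t ^ (-1 - q)) * |y| ^ q := by
  rcases eq_or_ne y 0 with rfl | hy
  · simp [Real.zero_rpow hq.ne']
  have hy_pos : 0 < |y| := abs_pos.2 hy
  have hscale : ∫ t in Set.Ioi (0 : ℝ), (1 - Real.cos (t * y)) * t ^ (-1 - q) =
      ∫ t in Set.Ioi (0 : ℝ),
        |y| ^ (1 + q) * ((1 - Real.cos (t * |y|)) * (t * |y|) ^ (-1 - q)) := by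
    refine setIntegral_congr_fun measurableSet_Ioi fun t ht => ?_
    have hcos : Real.cos (t * |y|) = Real.cos (t * y) := by
      rcases abs_choice y with h | h <;> rw [h]
      rw [mul_neg, Real.cos_neg]
    have hpow : |y| ^ (1 + q) * |y| ^ (-1 - q) = 1 := by
      rw [← Real.rpow_add hy_pos]
      simp
    rw [hcos, Real.mul_rpow (le_of_lt ht) hy_pos.le]
    linear_combination (-(1 - Real.cos (t * y)) * t ^ (-1 - q)) * hpow
  rw [hscale, integral_const_mul, integral_comp_mul_right_Ioi
    (fun t => (1 - Real.cos t) * t ^ (-1 - q)) 0 hy_pos, zero_mul, smul_eq_mul,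
    Real.rpow_add hy_pos, Real.rpow_one]
  field_simp

theorem integral_one_sub_cos_mul_rpow_pos {q : ℝ} (hq : 0 < q) (hq2 : q < 2) :
    0 < ∫ t in Set.Ioi (0 : ℝ), (1 - Real.cos t) * t ^ (-1 - q) := by
  have hint := integrableOn_one_sub_cos_mul_rpow hq hq2 1
  simp only [mul_one] at hint
  have hnonneg : ∀ t ∈ Set.Ioi (0 : ℝ), 0 ≤ (1 - Real.cos t) * t ^ (-1 - q) := fun t ht =>
    mul_nonneg (by linarith [Real.cos_le_one t]) (Real.rpow_nonneg (le_of_lt ht) _)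
  rw [setIntegral_pos_iff_support_of_nonneg_ae
    ((ae_restrict_mem measurableSet_Ioi).mono hnonneg) hint]
  refine lt_of_lt_of_le ?_ (measure_mono (s := Set.Ioo 0 1) ?_)
  · simp
  · intro t ht
    refine ⟨?_, ht.1⟩
    have hcos : Real.cos t < 1 := by
      rw [← Real.cos_zero]
      exact Real.cos_lt_cos_of_nonneg_of_le_pi le_rfl (by linarith [Real.pi_gt_three, ht.2]) ht.1
    exact (mul_pos (by linarith) (Real.rpow_pos_of_pos ht.1 _)).ne'

theorem isNegativeType_one_sub_cos : IsNegativeType fun x : ℝ => 1 - Real.cos x := by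
  intro ι _ c x hc
  have hform : ∑ i, ∑ j, c i * c j * (1 - Real.cos (x i - x j)) =
      (∑ i, c i) * (∑ j, c j) - (∑ i, c i * Real.cos (x i)) * (∑ j, c j * Real.cos (x j)) -
        (∑ i, c i * Real.sin (x i)) * (∑ j, c j * Real.sin (x j)) := by
    simp only [Finset.sum_mul_sum, ← Finset.sum_sub_distrib]
    refine Finset.sum_congr rfl fun i _ => Finset.sum_congr rfl fun j _ => ?_
    rw [Real.cos_sub]
    ring
  rw [hform, hc]
  linarith [mul_self_nonneg (∑ i, c i * Real.cos (x i)),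
    mul_self_nonneg (∑ i, c i * Real.sin (x i))]

variable {Ω : Type*} [MeasurableSpace Ω] {μ : Measure Ω} {q : ℝ}

theorem sum_sum_mul_integral_nonpos {ι : Type*} [Fintype ι] (c : ι → ℝ) {κ : ι → ι → Ω → ℝ}
    (hint : ∀ i j, Integrable (κ i j) μ)
    (hκ : ∀ᵐ ω ∂μ, ∑ i, ∑ j, c i * c j * κ i j ω ≤ 0) :
    ∑ i, ∑ j, c i * c j * ∫ ω, κ i j ω ∂μ ≤ 0 := by
  have hsum : ∑ i, ∑ j, c i * c j * ∫ ω, κ i j ω ∂μ =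
      ∫ ω, ∑ i, ∑ j, c i * c j * κ i j ω ∂μ := by
    rw [integral_finsetSum _ fun i _ => integrable_finsetSum _ fun j _ => (hint i j).const_mul _]
    refine Finset.sum_congr rfl fun i _ => ?_
    rw [integral_finsetSum _ fun j _ => (hint i j).const_mul _]
    simp only [integral_const_mul]
  exact hsum.trans_le (integral_nonpos_of_ae hκ)

theorem isNegativeType_abs_rpow (hq : 0 < q) (hq2 : q < 2) :
    IsNegativeType fun x : ℝ => |x| ^ q := by
  intro ι _ c x hc
  have hC := integral_one_sub_cos_mul_rpow_pos hq hq2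
  refine nonpos_of_mul_nonpos_right (a := ∫ t in Set.Ioi (0 : ℝ), (1 - Real.cos t) * t ^ (-1 - q))
    ?_ hC
  have h := sum_sum_mul_integral_nonpos c (μ := volume.restrict (Set.Ioi (0 : ℝ)))
    (κ := fun i j t => (1 - Real.cos (t * (x i - x j))) * t ^ (-1 - q))
    (fun i j => integrableOn_one_sub_cos_mul_rpow hq hq2 _) ?_
  · simp only [integral_one_sub_cos_mul_rpow hq] at h
    simpa only [Finset.mul_sum, mul_left_comm] using h
  · filter_upwards [ae_restrict_mem measurableSet_Ioi] with t ht
    simp only [← mul_assoc, ← Finset.sum_mul]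
    exact mul_nonpos_of_nonpos_of_nonneg
      (isNegativeType_one_sub_cos.comp_addMonoidHom (AddMonoidHom.mulLeft t) c x hc)
      (Real.rpow_nonneg (le_of_lt ht) _)

theorem integrable_abs_rpow_of_memLp (hq : 0 < q) {f : Ω → ℝ} (hf : MemLp f (ENNReal.ofReal q) μ) :
    Integrable (fun ω => |f ω| ^ q) μ := by
  have h := hf.integrable_norm_rpow (by simpa using hq) ENNReal.ofReal_ne_top
  simpa only [ENNReal.toReal_ofReal hq.le, Real.norm_eq_abs] using h

theorem norm_rpow_Lp (hq : 0 < q) (f : Lp ℝ (ENNReal.ofReal q) μ) :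
    ‖f‖ ^ q = ∫ ω, |f ω| ^ q ∂μ := by
  have h := (Lp.memLp f).eLpNorm_eq_integral_rpow_norm (by simpa using hq) ENNReal.ofReal_ne_top
  have hnonneg : 0 ≤ ∫ ω, |f ω| ^ q ∂μ :=
    integral_nonneg fun ω => Real.rpow_nonneg (abs_nonneg _) _
  simp only [ENNReal.toReal_ofReal hq.le, Real.norm_eq_abs] at h
  rw [Lp.norm_def, h, ENNReal.toReal_ofReal (Real.rpow_nonneg hnonneg _), ← Real.rpow_mul hnonneg,
    inv_mul_cancel₀ hq.ne', Real.rpow_one]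

theorem isNegativeType_norm_rpow_Lp (hq : 0 < q) (hq2 : q < 2) :
    IsNegativeType fun f : Lp ℝ (ENNReal.ofReal q) μ => ‖f‖ ^ q := by
  intro ι _ c f hc
  simp only [norm_rpow_Lp hq]
  refine sum_sum_mul_integral_nonpos c
    (fun i j => integrable_abs_rpow_of_memLp hq (Lp.memLp (f i - f j))) ?_
  filter_upwards [ae_all_iff.2 fun i => ae_all_iff.2 fun j => Lp.coeFn_sub (f i) (f j)] with ω hω
  simpa only [hω, Pi.sub_apply] using isNegativeType_abs_rpow hq hq2 c (fun i => f i ω) hc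

end NegativeType

section Derivative

theorem abs_mul_rpow_mul_add_mul_le {q : ℝ} (hq : 1 < q) (u v : ℝ) {t : ℝ} (ht : |t| ≤ 1) :
    |q * |u + t * v| ^ (q - 2) * (u + t * v) * v| ≤ q * (|u| + |v|) ^ q := by
  have hpow : ∀ s : ℝ, 0 ≤ s → ∀ p : ℝ, p + 1 ≠ 0 → s ^ p * s = s ^ (p + 1) := fun s hs p hp =>
    (Real.rpow_add_one' hs hp).symm
  have htv : |t * v| ≤ |v| := by
    rw [abs_mul]
    exact mul_le_of_le_one_left (abs_nonneg v) ht
  have hle : |u + t * v| ≤ |u| + |v| := (abs_add_le _ _).trans (add_le_add_right htv _)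
  calc |q * |u + t * v| ^ (q - 2) * (u + t * v) * v|
      = q * (|u + t * v| ^ (q - 2) * |u + t * v| * |v|) := by
        rw [abs_mul, abs_mul, abs_mul, abs_of_pos (zero_lt_one.trans hq),
          abs_of_nonneg (Real.rpow_nonneg (abs_nonneg _) _), mul_assoc q, mul_assoc q]
    _ = q * (|u + t * v| ^ (q - 1) * |v|) := by
        rw [hpow _ (abs_nonneg _) _ (by linarith)]
        ring_nf
    _ ≤ q * ((|u| + |v|) ^ (q - 1) * (|u| + |v|)) := by
        gcongr
        exact le_add_of_nonneg_left (abs_nonneg u)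
    _ = q * (|u| + |v|) ^ q := by
        rw [hpow _ (by positivity) _ (by linarith), sub_add_cancel]

variable {Ω : Type*} [MeasurableSpace Ω] {μ : Measure Ω} {q : ℝ}

theorem hasDerivAt_integral_abs_add_mul_rpow (hq : 1 < q) {f g : Ω → ℝ}
    (hf : MemLp f (ENNReal.ofReal q) μ) (hg : MemLp g (ENNReal.ofReal q) μ) :
    HasDerivAt (fun t : ℝ => ∫ ω, |f ω + t * g ω| ^ q ∂μ)
      (∫ ω, q * |f ω| ^ (q - 2) * f ω * g ω ∂μ) 0 := by
  have hq0 : 0 < q := zero_lt_one.trans hq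
  have hline : ∀ t : ℝ, Integrable (fun ω => |f ω + t * g ω| ^ q) μ := fun t =>
    integrable_abs_rpow_of_memLp hq0 (hf.add (hg.const_mul t))
  have hbound : Integrable (fun ω => q * (|f ω| + |g ω|) ^ q) μ := by
    refine Integrable.const_mul ?_ q
    simpa [abs_of_nonneg (add_nonneg (abs_nonneg (f _)) (abs_nonneg (g _)))] using
      integrable_abs_rpow_of_memLp hq0 (hf.norm.add hg.norm)
  have hderiv : ∀ (ω : Ω) (t : ℝ), HasDerivAt (fun t : ℝ => |f ω + t * g ω| ^ q)
      (q * |f ω + t * g ω| ^ (q - 2) * (f ω + t * g ω) * g ω) t := fun ω t =>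
    (hasDerivAt_abs_rpow _ hq).comp t (((hasDerivAt_mul_const (g ω)).const_add (f ω)))
  have hmf := hf.aestronglyMeasurable.aemeasurable
  have hmg := hg.aestronglyMeasurable.aemeasurable
  have h := (hasDerivAt_integral_of_dominated_loc_of_deriv_le
    (F' := fun t ω => q * |f ω + t * g ω| ^ (q - 2) * (f ω + t * g ω) * g ω)
    (Metric.ball_mem_nhds (0 : ℝ) one_pos)
    (Filter.Eventually.of_forall fun t => (hline t).aestronglyMeasurable) (hline 0)
    (AEMeasurable.aestronglyMeasurable (by fun_prop))
    (Filter.Eventually.of_forall fun ω t ht => abs_mul_rpow_mul_add_mul_le hq (f ω) (g ω)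
      (by simpa using (Metric.mem_ball.1 ht).le)) hbound
    (Filter.Eventually.of_forall fun ω t _ => hderiv ω t)).2
  simpa only [zero_mul, add_zero] using h

theorem differentiableAt_norm_add_smul_rpow_Lp (hq : 1 < q) (f g : Lp ℝ (ENNReal.ofReal q) μ) :
    DifferentiableAt ℝ (fun t : ℝ => ‖f + t • g‖ ^ q) 0 := by
  have hnorm : (fun t : ℝ => ‖f + t • g‖ ^ q) = fun t => ∫ ω, |f ω + t * g ω| ^ q ∂μ := by
    funext t
    rw [norm_rpow_Lp (zero_lt_one.trans hq)]
    refine integral_congr_ae ?_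
    filter_upwards [Lp.coeFn_add f (t • g), Lp.coeFn_smul t g] with ω hadd hsmul
    rw [hadd, Pi.add_apply, hsmul, Pi.smul_apply, smul_eq_mul]
  rw [hnorm]
  exact (hasDerivAt_integral_abs_add_mul_rpow hq (Lp.memLp f) (Lp.memLp g)).differentiableAt

end Derivative

section LorentzSum

variable {n : ℕ}

/-- The `q`-th power of the Lorentz norm with weights `a`, as a function that makes sense for all
real weights. -/
noncomputable def lorentzSum (a : Fin n → ℝ) (q : ℝ) (x : Fin n → ℝ) : ℝ :=
  ∑ k, a k * decreasingRearrangement x k ^ q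

theorem decreasingRearrangement_eq_of_antitone {x : Fin n → ℝ} {σ : Equiv.Perm (Fin n)}
    (h : Antitone fun k => |x (σ k)|) : decreasingRearrangement x = fun k => |x (σ k)| := by
  have hsort := (Tuple.comp_sort_eq_comp_iff_monotone (f := fun i => -|x i|) (σ := σ)).2
    (fun i j hij => neg_le_neg (h hij))
  funext k
  exact neg_inj.1 (congrFun hsort k).symm

theorem decreasingRearrangement_comp_perm (x : Fin n → ℝ) (σ : Equiv.Perm (Fin n)) :
    decreasingRearrangement (x ∘ σ) = decreasingRearrangement x :=
  (decreasingRearrangement_eq_of_antitone (σ := σ * Tuple.sort fun i => -|x (σ i)|)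
    (decreasingRearrangement_antitone (x ∘ σ))).symm

theorem lorentzSum_nonneg {a : Fin n → ℝ} (ha : ∀ i, 0 ≤ a i) (q : ℝ) (x : Fin n → ℝ) :
    0 ≤ lorentzSum a q x :=
  Finset.sum_nonneg fun k _ => mul_nonneg (ha k) (Real.rpow_nonneg (abs_nonneg _) q)

theorem lorentzNorm_rpow {a : Fin n → ℝ} (ha : ∀ i, 0 ≤ a i) {q : ℝ} (hq : q ≠ 0)
    (x : Fin n → ℝ) : lorentzNorm a q x ^ q = lorentzSum a q x := by
  change (lorentzSum a q x ^ (1 / q)) ^ q = _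
  rw [← Real.rpow_mul (lorentzSum_nonneg ha q x), one_div_mul_cancel hq, Real.rpow_one]

theorem lorentzSum_comp_perm (a : Fin n → ℝ) (q : ℝ) (x : Fin n → ℝ) (σ : Equiv.Perm (Fin n)) :
    lorentzSum a q (x ∘ σ) = lorentzSum a q x := by
  rw [lorentzSum, decreasingRearrangement_comp_perm, lorentzSum]

theorem lorentzSum_neg (a : Fin n → ℝ) (q : ℝ) (x : Fin n → ℝ) :
    lorentzSum a q (-x) = lorentzSum a q x := by
  simp only [lorentzSum, decreasingRearrangement, Pi.neg_apply, abs_neg]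

theorem lorentzSum_eq_of_antitone (a : Fin n → ℝ) (q : ℝ) {x : Fin n → ℝ}
    (h : Antitone fun k => |x k|) : lorentzSum a q x = ∑ k, a k * |x k| ^ q := by
  simp only [lorentzSum, decreasingRearrangement_eq_of_antitone (σ := 1) h, Equiv.Perm.coe_one, id]

theorem lorentzSum_const (c q : ℝ) (x : Fin n → ℝ) :
    lorentzSum (fun _ => c) q x = c * ∑ i, |x i| ^ q := by
  rw [lorentzSum, ← Finset.mul_sum]
  exact congrArg (c * ·) (Equiv.sum_comp (Tuple.sort fun i => -|x i|) fun i => |x i| ^ q)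

theorem sum_sum_ne_min (g : Fin n → ℝ) :
    (∑ i, ∑ j, if i ≠ j then g (min i j) else 0) = 2 * ∑ k : Fin n, ((n : ℝ) - 1 - k) * g k := by
  have hsplit : ∀ i j : Fin n, (if i ≠ j then g (min i j) else 0)
      = (if i < j then g i else 0) + (if j < i then g j else 0) := by
    intro i j
    rcases lt_trichotomy i j with h | h | h
    · simp [h.ne, h, h.not_gt, min_eq_left h.le]
    · simp [h]
    · simp [h.ne', h, h.not_gt, min_eq_right h.le]
  have hcount : ∀ i : Fin n, (∑ j, if i < j then g i else 0) = ((n : ℝ) - 1 - i) * g i := by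
    intro i
    rw [← Finset.sum_filter, Finset.sum_const, nsmul_eq_mul, Finset.filter_lt_eq_Ioi, Fin.card_Ioi,
      Nat.cast_sub (Nat.le_sub_one_of_lt i.isLt), Nat.cast_sub (Nat.one_le_of_lt i.isLt),
      Nat.cast_one]
  simp only [hsplit, Finset.sum_add_distrib]
  rw [Finset.sum_comm (f := fun i j => if j < i then g j else 0), ← two_mul]
  simp only [hcount]

theorem lorentzSum_eq_sum_max (q b d : ℝ) (x : Fin n → ℝ) :
    lorentzSum (fun k : Fin n => b + d * ((n : ℝ) - 1 - k)) q x =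
      (∑ i, ∑ j, if i ≠ j then d / 2 * max |x i| |x j| ^ q else 0) + ∑ i, b * |x i| ^ q := by
  let σ := Tuple.sort fun i => -|x i|
  have hsum : (∑ i, b * |x i| ^ q) = ∑ i, b * decreasingRearrangement x i ^ q :=
    (Equiv.sum_comp σ fun i => b * |x i| ^ q).symm
  have hmax : (∑ i, ∑ j, if i ≠ j then d / 2 * max |x i| |x j| ^ q else 0) =
      ∑ i, ∑ j, if i ≠ j then d / 2 * decreasingRearrangement x (min i j) ^ q else 0 := by
    rw [← Equiv.sum_comp σ]
    refine Finset.sum_congr rfl fun i _ => ?_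
    rw [← Equiv.sum_comp σ]
    refine Finset.sum_congr rfl fun j _ => ?_
    rw [(decreasingRearrangement_antitone x).map_min]
    simp only [ne_eq, EmbeddingLike.apply_eq_iff_eq]
    rfl
  rw [hsum, hmax, sum_sum_ne_min fun i => d / 2 * decreasingRearrangement x i ^ q, lorentzSum,
    Finset.mul_sum, ← Finset.sum_add_distrib]
  exact Finset.sum_congr rfl fun k _ => by ring

end LorentzSum

section BlockVector

variable {n k : ℕ}

/-- The linear map sending `(z, p, r)` to the vector `(z, …, z, p, r, 0, …, 0)` with `k` entries
`z`. It is used for `k + 1 < n`, when no entry is cut off. -/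
def blockVector (n k : ℕ) : ℝ × ℝ × ℝ →ₗ[ℝ] Fin n → ℝ where
  toFun v i :=
    if i.val < k then v.1 else if i.val = k then v.2.1 else if i.val = k + 1 then v.2.2 else 0
  map_add' v w := by
    ext i
    simp only [Pi.add_apply, Prod.fst_add, Prod.snd_add]
    split_ifs <;> simp only [add_zero]
  map_smul' c v := by
    ext i
    simp only [Pi.smul_apply, Prod.smul_fst, Prod.smul_snd, RingHom.id_apply]
    split_ifs <;> simp only [smul_zero]

theorem blockVector_apply (n k : ℕ) (z p r : ℝ) (i : Fin n) : blockVector n k (z, p, r) i =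
    if i.val < k then z else if i.val = k then p else if i.val = k + 1 then r else 0 := rfl

theorem lorentzSum_blockVector_swap (hk : k + 1 < n) (a : Fin n → ℝ) (q z p r : ℝ) :
    lorentzSum a q (blockVector n k (z, r, p)) = lorentzSum a q (blockVector n k (z, p, r)) := by
  rw [← lorentzSum_comp_perm a q (blockVector n k (z, p, r))
    (Equiv.swap ⟨k, Nat.lt_of_succ_lt hk⟩ ⟨k + 1, hk⟩)]
  congr 1
  ext i
  rw [Function.comp_apply, Equiv.swap_apply_def]
  simp only [blockVector_apply, Fin.ext_iff]
  grind

theorem lorentzSum_blockVector_of_le (hk : k + 1 < n) (a : Fin n → ℝ) {q : ℝ} (hq : q ≠ 0)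
    {z p r : ℝ} (hpz : |p| ≤ |z|) (hrp : |r| ≤ |p|) :
    lorentzSum a q (blockVector n k (z, p, r)) =
      (∑ i : Fin n, if i.val < k then a i * |z| ^ q else 0)
        + a ⟨k, Nat.lt_of_succ_lt hk⟩ * |p| ^ q + a ⟨k + 1, hk⟩ * |r| ^ q := by
  rw [lorentzSum_eq_of_antitone]
  · have hterm : ∀ i : Fin n, a i * |blockVector n k (z, p, r) i| ^ q =
        (if i.val < k then a i * |z| ^ q else 0)
        + (if i = ⟨k, Nat.lt_of_succ_lt hk⟩ then a i * |p| ^ q else 0)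
        + (if i = ⟨k + 1, hk⟩ then a i * |r| ^ q else 0) := by
      intro i
      simp only [blockVector_apply, Fin.ext_iff]
      split_ifs <;> first | omega | simp [Real.zero_rpow hq]
    simp only [hterm, Finset.sum_add_distrib, Finset.sum_ite_eq', Finset.mem_univ, if_true]
  · intro i j hij
    have hr := abs_nonneg r
    simp only [blockVector_apply]
    split_ifs <;> first | omega | linarith [abs_zero (α := ℝ)]

/-- The permutation of `Fin n` that moves the positions `k`, `k + 1` to the front. -/
def bringToFront (hk : k + 1 < n) : Equiv.Perm (Fin n) where
  toFun i := if h : i.val < k then ⟨i.val + 2, by omega⟩ else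
    if i.val = k then ⟨0, by omega⟩ else if i.val = k + 1 then ⟨1, by omega⟩ else i
  invFun i := if i.val = 0 then ⟨k, by omega⟩ else if i.val = 1 then ⟨k + 1, hk⟩ else
    if i.val < k + 2 then ⟨i.val - 2, by omega⟩ else i
  left_inv i := by grind
  right_inv i := by grind

theorem lorentzSum_blockVector_of_ge (hk : k + 1 < n) (a : Fin n → ℝ) {q : ℝ} (hq : q ≠ 0)
    {z p r : ℝ} (hzr : |z| ≤ |r|) (hrp : |r| ≤ |p|) :
    lorentzSum a q (blockVector n k (z, p, r)) =
      (∑ i : Fin n, if 2 ≤ i.val ∧ i.val < k + 2 then a i * |z| ^ q else 0)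
        + a ⟨0, by omega⟩ * |p| ^ q + a ⟨1, by omega⟩ * |r| ^ q := by
  let y : Fin n → ℝ := fun i =>
    if i.val = 0 then p else if i.val = 1 then r else if i.val < k + 2 then z else 0
  have hy : blockVector n k (z, p, r) = y ∘ bringToFront hk := by
    ext i
    simp only [blockVector_apply, Function.comp_apply, y, bringToFront, Equiv.coe_fn_mk]
    grind
  rw [hy, lorentzSum_comp_perm, lorentzSum_eq_of_antitone]
  · have hterm : ∀ i : Fin n, a i * |y i| ^ q =
        (if 2 ≤ i.val ∧ i.val < k + 2 then a i * |z| ^ q else 0)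
        + (if i = ⟨0, by omega⟩ then a i * |p| ^ q else 0)
        + (if i = ⟨1, by omega⟩ then a i * |r| ^ q else 0) := by
      intro i
      simp only [y, Fin.ext_iff]
      split_ifs <;> first | omega | simp [Real.zero_rpow hq]
    simp only [hterm, Finset.sum_add_distrib, Finset.sum_ite_eq', Finset.mem_univ, if_true]
  · intro i j hij
    have hz := abs_nonneg z
    simp only [y]
    split_ifs <;> first | omega | linarith [abs_zero (α := ℝ)]

theorem lorentzSum_blockVector_sub_of_le (hk : k + 1 < n) (a : Fin n → ℝ) {q : ℝ} (hq : q ≠ 0)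
    {z s u : ℝ} (hs : 0 ≤ s) (hu : 0 ≤ u) (hz : s + u ≤ |z|) :
    lorentzSum a q (blockVector n k (z, s + u, s - u)) -
        lorentzSum a q (blockVector n k (z, s, s)) =
      a ⟨k, Nat.lt_of_succ_lt hk⟩ * ((s + u) ^ q - s ^ q) -
        a ⟨k + 1, hk⟩ * (s ^ q - |s - u| ^ q) := by
  have hsum : |s + u| = s + u := abs_of_nonneg (add_nonneg hs hu)
  have hle : |s - u| ≤ |s + u| := by
    rw [hsum, abs_le]
    constructor <;> linarith
  rw [lorentzSum_blockVector_of_le hk a hq (hsum.trans_le hz) hle,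
    lorentzSum_blockVector_of_le hk a hq (by rw [abs_of_nonneg hs]; linarith) le_rfl, hsum,
    abs_of_nonneg hs]
  ring

theorem lorentzSum_blockVector_sub_of_ge (hk : k + 1 < n) (a : Fin n → ℝ) {q : ℝ} (hq : q ≠ 0)
    {z s u : ℝ} (hs : 0 ≤ s) (hu : 0 ≤ u) (hz : |z| ≤ s) (hzu : |z| ≤ |s - u|) :
    lorentzSum a q (blockVector n k (z, s + u, s - u)) -
        lorentzSum a q (blockVector n k (z, s, s)) =
      a ⟨0, by omega⟩ * ((s + u) ^ q - s ^ q) - a ⟨1, by omega⟩ * (s ^ q - |s - u| ^ q) := by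
  have hsum : |s + u| = s + u := abs_of_nonneg (add_nonneg hs hu)
  have hle : |s - u| ≤ |s + u| := by
    rw [hsum, abs_le]
    constructor <;> linarith
  rw [lorentzSum_blockVector_of_ge hk a hq hzu hle,
    lorentzSum_blockVector_of_ge hk a hq (by rwa [abs_of_nonneg hs]) le_rfl, hsum,
    abs_of_nonneg hs]
  ring

end BlockVector

section NecessityNegativeType

variable {n k : ℕ} {a : Fin n → ℝ} {q : ℝ}

theorem hasDerivAt_one_add_mul_rpow (c q : ℝ) :
    HasDerivAt (fun t : ℝ => (1 + c * t) ^ q) (q * c) 0 := by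
  have hlin : HasDerivAt (fun t : ℝ => 1 + c * t) c 0 := by
    simpa using ((hasDerivAt_id (0 : ℝ)).const_mul c).const_add 1
  exact (hlin.rpow_const (p := q) (Or.inl (by simp))).congr_deriv (by simp [mul_comm])

theorem tendsto_natCast_mul_one_sub_rpow (c q : ℝ) :
    Filter.Tendsto (fun K : ℕ => (K : ℝ) * (1 - (1 - c * (K : ℝ)⁻¹) ^ q)) Filter.atTop
      (nhds (q * c)) := by
  have hderiv : HasDerivAt (fun y : ℝ => 1 - (1 - c * y) ^ q) (q * c) 0 := by
    simpa only [neg_mul, ← sub_eq_add_neg, mul_neg, neg_neg] using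
      (hasDerivAt_one_add_mul_rpow (-c) q).const_sub 1
  have hinv : Filter.Tendsto (fun K : ℕ => (K : ℝ)⁻¹) Filter.atTop (nhdsWithin 0 {0}ᶜ) :=
    (tendsto_inv_atTop_nhdsGT_zero.comp tendsto_natCast_atTop_atTop).mono_right
      (nhdsWithin_mono 0 fun y hy => (Set.mem_Ioi.1 hy).ne')
  simpa [Function.comp_def] using (hasDerivAt_iff_tendsto_slope_zero.1 hderiv).comp hinv

theorem sub_rpow_eq_rpow_mul {x c : ℝ} (hx : 0 < x) (hc : c ≤ x) :
    (x - c) ^ q = x ^ q * (1 - c * x⁻¹) ^ q := by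
  have hfactor : x - c = x * (1 - c * x⁻¹) := by field_simp
  have hnonneg : 0 ≤ 1 - c * x⁻¹ := sub_nonneg.2 (mul_inv_le_one_of_le₀ hc hx.le)
  rw [hfactor, Real.mul_rpow hx.le hnonneg]

theorem eq_of_forall_mul_abs_sub_le {α β C : ℝ} (hq : 0 < q)
    (h : ∀ K : ℕ, 0 < K → K * |α * ((K : ℝ) ^ q - ((K : ℝ) - 1 / 2) ^ q)
      - β * (((K : ℝ) - 1 / 2) ^ q - ((K : ℝ) - 1) ^ q)| ≤ C) : α = β := by
  have hhalf := tendsto_natCast_mul_one_sub_rpow (1 / 2) q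
  have hlim := ((hhalf.const_mul α).sub
    (((tendsto_natCast_mul_one_sub_rpow 1 q).sub hhalf).const_mul β)).abs
  have hbound : Filter.Tendsto (fun K : ℕ => C * (K : ℝ) ^ (-q)) Filter.atTop (nhds (C * 0)) :=
    ((tendsto_rpow_neg_atTop hq).comp tendsto_natCast_atTop_atTop).const_mul C
  have hle := le_of_tendsto_of_tendsto hlim hbound (by
    filter_upwards [Filter.eventually_gt_atTop 0] with K hK
    have hK0 : (0 : ℝ) < K := by exact_mod_cast hK
    have hK1 : (1 : ℝ) ≤ K := by exact_mod_cast hK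
    have hKq := Real.rpow_pos_of_pos hK0 q
    have hle := h K hK
    rw [← abs_of_pos hK0, ← abs_mul, abs_of_pos hK0, sub_rpow_eq_rpow_mul hK0 (by linarith),
      sub_rpow_eq_rpow_mul hK0 hK1] at hle
    rw [Real.rpow_neg hK0.le, ← div_eq_mul_inv C, le_div_iff₀ hKq, ← abs_of_pos hKq, ← abs_mul]
    refine hle.trans_eq' ?_
    congr 1
    ring)
  have hzero : q / 2 * (α - β) = 0 := by
    refine abs_nonpos_iff.1 ((hle.trans_eq (mul_zero C)).trans_eq' ?_)
    ring_nf
  exact sub_eq_zero.1 ((mul_eq_zero.1 hzero).resolve_left (half_pos hq).ne')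

theorem isPositiveDefinite_lorentzSum_blockVector (hN : IsNegativeType (lorentzSum a q))
    (hk : k + 1 < n) (u : ℝ) : IsPositiveDefinite fun x : ℝ × ℝ =>
      lorentzSum a q (blockVector n k (x.2, x.1 + u, x.1 - u)) -
        lorentzSum a q (blockVector n k (x.2, x.1, x.1)) := by
  intro ι _ c x
  have hblock := hN.comp_addMonoidHom (blockVector n k).toAddMonoidHom
  have h := hblock.isPositiveDefinite_second_difference (0, u, -u) c
    fun i => ((x i).2, (x i).1, (x i).1)
  simp only [LinearMap.toAddMonoidHom_coe, Prod.mk_add_mk, Prod.mk_sub_mk, add_zero, sub_zero,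
    sub_neg_eq_add, ← sub_eq_add_neg, lorentzSum_blockVector_swap hk a q _ (_ + u) (_ - u),
    ← two_mul, ← mul_sub, mul_left_comm _ (2 : ℝ), ← Finset.mul_sum] at h
  exact nonneg_of_mul_nonneg_right h two_pos

theorem even_lorentzSum_blockVector (hk : k + 1 < n) (a : Fin n → ℝ) (q u : ℝ) :
    Function.Even fun x : ℝ × ℝ =>
      lorentzSum a q (blockVector n k (x.2, x.1 + u, x.1 - u)) -
        lorentzSum a q (blockVector n k (x.2, x.1, x.1)) := by
  have hneg : ∀ z p r, lorentzSum a q (blockVector n k (-z, -p, -r)) =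
      lorentzSum a q (blockVector n k (z, p, r)) := fun z p r => by
    rw [← Prod.neg_mk, ← Prod.neg_mk, map_neg, lorentzSum_neg]
  intro x
  simp only [Prod.fst_neg, Prod.snd_neg, neg_add_eq_sub, ← neg_sub x.1 u, ← neg_add', hneg,
    lorentzSum_blockVector_swap hk a q _ (_ + u) (_ - u)]

theorem IsNegativeType.apply_sub_apply_succ_eq (hN : IsNegativeType (lorentzSum a q)) (hq : 0 < q)
    (hk : k + 1 < n) :
    a ⟨k, Nat.lt_of_succ_lt hk⟩ - a ⟨k + 1, hk⟩ = a ⟨0, by omega⟩ - a ⟨1, by omega⟩ := by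
  suffices hdiff : a ⟨0, by omega⟩ - a ⟨k, Nat.lt_of_succ_lt hk⟩ =
      a ⟨1, by omega⟩ - a ⟨k + 1, hk⟩ by linarith
  refine eq_of_forall_mul_abs_sub_le (C := (a ⟨0, by omega⟩ + a ⟨1, by omega⟩) * (1 / 2) ^ q -
    (a ⟨k, Nat.lt_of_succ_lt hk⟩ + a ⟨k + 1, hk⟩) * (1 / 2) ^ q) hq fun K hK => ?_
  have hK1 : (1 : ℝ) ≤ K := by exact_mod_cast hK
  have hhalf : (0 : ℝ) ≤ 1 / 2 := by norm_num
  have h0q := Real.zero_rpow hq.ne'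
  have hS : |(K : ℝ) - 1 / 2 - 1 / 2| = K - 1 := by
    rw [abs_of_nonneg] <;> linarith
  have hS' : (K : ℝ) - 1 / 2 + 1 / 2 = K := sub_add_cancel _ _
  have habs : |(0 : ℝ) - 1 / 2| = 1 / 2 := by norm_num [abs_of_pos]
  have hmain := (isPositiveDefinite_lorentzSum_blockVector hN hk (1 / 2)).mul_abs_sub_le
    (even_lorentzSum_blockVector hk a q (1 / 2)) hK (S := K - 1 / 2)
    (fun z hz => lorentzSum_blockVector_sub_of_le hk a hq.ne' le_rfl hhalf (by linarith))
    (fun z hz => lorentzSum_blockVector_sub_of_ge hk a hq.ne' (by linarith) hhalf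
      (by linarith) (hz.trans_eq hS.symm))
    (fun z hz => lorentzSum_blockVector_sub_of_le hk a hq.ne' (by linarith) hhalf
      (hS'.trans_le hz))
  dsimp only [Prod.fst_zero, Prod.snd_zero] at hmain
  rw [lorentzSum_blockVector_sub_of_ge hk a hq.ne' le_rfl hhalf (by simp) (by simp), hS, hS', habs,
    h0q, zero_add] at hmain
  refine (Eq.trans_le ?_ hmain).trans_eq (by ring)
  congr 2
  ring

theorem IsNegativeType.equalDifferences (hN : IsNegativeType (lorentzSum a q)) (hq : 0 < q) :
    EqualDifferences a := fun i j hi hj => by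
  rw [hN.apply_sub_apply_succ_eq hq hi, hN.apply_sub_apply_succ_eq hq hj]

theorem IsNegativeType.apply_one_le_apply_zero (hN : IsNegativeType (lorentzSum a q)) (hq : 0 < q)
    (hn : 1 < n) : a ⟨1, hn⟩ ≤ a ⟨0, by omega⟩ := by
  have hval : ∀ p r, |r| ≤ |p| → lorentzSum a q (blockVector n 0 (0, p, r)) =
      a ⟨0, by omega⟩ * |p| ^ q + a ⟨1, hn⟩ * |r| ^ q := fun p r hpr => by
    simpa [Real.zero_rpow hq.ne'] using
      lorentzSum_blockVector_of_ge (k := 0) (z := 0) hn a hq.ne' (by simp) hpr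
  have hblock := hN.comp_addMonoidHom (blockVector n 0).toAddMonoidHom
  have heven := even_second_difference (N := fun x => lorentzSum a q (blockVector n 0 x))
    (fun x => by beta_reduce; rw [map_neg, lorentzSum_neg]) (0, 1, 0)
  have hle := (hblock.isPositiveDefinite_second_difference (0, 1, 0)).abs_le_apply_zero heven
    (0, 0, 1)
  rw [← Prod.mk_zero_zero, ← Prod.mk_zero_zero] at hle
  simp only [LinearMap.toAddMonoidHom_coe, Prod.mk_add_mk, Prod.mk_sub_mk, add_zero, zero_add,
    sub_zero, zero_sub, lorentzSum_blockVector_swap (k := 0) hn a q 0 1 0] at hle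
  rw [hval 1 1 le_rfl, hval (-1) 1 (by simp), hval 1 0 (by simp), hval (-1) 0 (by simp),
    hval 0 0 le_rfl, abs_neg, abs_one, abs_zero, Real.one_rpow, Real.zero_rpow hq.ne'] at hle
  linarith [le_of_abs_le hle]

theorem IsNegativeType.antitone (hN : IsNegativeType (lorentzSum a q)) (hq : 0 < q) :
    Antitone a := by
  obtain _ | n := n
  · exact fun i => i.elim0
  refine Fin.antitone_iff_succ_le.2 fun i => ?_
  have hn : 1 < n + 1 := Nat.succ_lt_succ i.pos
  have hstep := hN.equalDifferences hq i 0 (Nat.succ_lt_succ i.isLt) hn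
  exact sub_nonneg.1 (hstep.symm ▸ sub_nonneg.2 (hN.apply_one_le_apply_zero hq hn))

end NecessityNegativeType

section NecessityDerivative

variable {n k : ℕ} {a : Fin n → ℝ} {q : ℝ}

theorem deriv_zero_eq_zero_of_even {f : ℝ → ℝ} (hf : f.Even) : deriv f 0 = 0 := by
  have hneg := deriv_comp_neg f 0
  rw [neg_zero, funext hf] at hneg
  linarith

theorem apply_eq_apply_succ_of_differentiableAt (hq : 0 < q) (hk : k + 1 < n)
    (hdiff : DifferentiableAt ℝ (fun t : ℝ =>
      lorentzSum a q (blockVector n k (2, 1, 1) + t • blockVector n k (0, 1, -1))) 0) :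
    a ⟨k, Nat.lt_of_succ_lt hk⟩ = a ⟨k + 1, hk⟩ := by
  set Φ := fun t : ℝ => lorentzSum a q (blockVector n k (2, 1, 1) + t • blockVector n k (0, 1, -1))
    with hΦ
  have hblock : ∀ t, Φ t = lorentzSum a q (blockVector n k (2, 1 + t, 1 - t)) := fun t => by
    simp only [hΦ, ← map_smul, ← map_add, Prod.smul_mk, smul_eq_mul, Prod.mk_add_mk, mul_zero,
      mul_one, mul_neg, add_zero, sub_eq_add_neg]
  have heven : Φ.Even := fun t => by
    rw [hblock, hblock, sub_neg_eq_add, ← sub_eq_add_neg, lorentzSum_blockVector_swap hk]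
  obtain ⟨C, hC⟩ : ∃ C, ∀ t ∈ Set.Icc (0 : ℝ) 1, Φ t =
      C + a ⟨k, Nat.lt_of_succ_lt hk⟩ * (1 + 1 * t) ^ q + a ⟨k + 1, hk⟩ * (1 + -1 * t) ^ q := by
    refine ⟨∑ i : Fin n, if i.val < k then a i * |2| ^ q else 0, fun t ht => ?_⟩
    have hadd : |1 + t| = 1 + t := abs_of_nonneg (by linarith [ht.1])
    have hsub : |1 - t| = 1 - t := abs_of_nonneg (by linarith [ht.2])
    rw [hblock, lorentzSum_blockVector_of_le hk a hq.ne'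
      (by rw [hadd, abs_two]; linarith [ht.2]) (by rw [hadd, hsub]; linarith [ht.1]), hadd, hsub,
      one_mul, neg_one_mul, ← sub_eq_add_neg]
  have hright : HasDerivWithinAt Φ (q * (a ⟨k, Nat.lt_of_succ_lt hk⟩ - a ⟨k + 1, hk⟩))
      (Set.Icc 0 1) 0 :=
    ((((hasDerivAt_one_add_mul_rpow 1 q).const_mul _).const_add C).add
      ((hasDerivAt_one_add_mul_rpow (-1) q).const_mul _)).congr_deriv (by ring)
      |>.hasDerivWithinAt.congr hC (hC 0 (by simp))
  have hzero := (uniqueDiffOn_Icc_zero_one 0 (by simp)).eq_deriv _ hright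
    hdiff.hasDerivAt.hasDerivWithinAt
  rw [deriv_zero_eq_zero_of_even heven] at hzero
  exact sub_eq_zero.1 ((mul_eq_zero.1 hzero).resolve_left hq.ne')

end NecessityDerivative

namespace LorentzEmbedsInLq

variable {Ω : Type*} [MeasurableSpace Ω] {μ : Measure Ω} {n : ℕ} {a : Fin n → ℝ} {q : ℝ}

theorem exists_linearMap_norm_rpow_eq (h : LorentzEmbedsInLq a q μ) (ha : ∀ i, 0 ≤ a i)
    (hq : q ≠ 0) : ∃ T : (Fin n → ℝ) →ₗ[ℝ] Lp ℝ (ENNReal.ofReal q) μ,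
      lorentzSum a q = fun x => ‖T x‖ ^ q :=
  h.imp fun T hT => funext fun x => by rw [hT, lorentzNorm_rpow ha hq]

theorem isNegativeType_lorentzSum (h : LorentzEmbedsInLq a q μ) (ha : ∀ i, 0 ≤ a i) (hq : 0 < q)
    (hq2 : q < 2) : IsNegativeType (lorentzSum a q) := by
  obtain ⟨T, hT⟩ := h.exists_linearMap_norm_rpow_eq ha hq.ne'
  rw [hT]
  exact (isNegativeType_norm_rpow_Lp hq hq2).comp_addMonoidHom T.toAddMonoidHom

theorem differentiableAt_lorentzSum_add_smul (h : LorentzEmbedsInLq a q μ) (ha : ∀ i, 0 ≤ a i)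
    (hq : 1 < q) (x y : Fin n → ℝ) :
    DifferentiableAt ℝ (fun t : ℝ => lorentzSum a q (x + t • y)) 0 := by
  obtain ⟨T, hT⟩ := h.exists_linearMap_norm_rpow_eq ha (one_pos.trans hq).ne'
  simpa only [hT, map_add, map_smul] using differentiableAt_norm_add_smul_rpow_Lp hq (T x) (T y)

theorem antitone_and_equalDifferences (h : LorentzEmbedsInLq a q μ) (ha : ∀ i, 0 ≤ a i)
    (hq : 0 < q) (hq2 : q < 2) : Antitone a ∧ EqualDifferences a :=
  have hN := h.isNegativeType_lorentzSum ha hq hq2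
  ⟨hN.antitone hq, hN.equalDifferences hq⟩

theorem eq_of_one_lt (h : LorentzEmbedsInLq a q μ) (ha : ∀ i, 0 ≤ a i) (hq : 1 < q)
    (i j : Fin n) : a i = a j := by
  have heq : ∀ (m : ℕ) (hm : m < n), a ⟨m, hm⟩ = a ⟨0, by omega⟩ := by
    intro m
    induction m with
    | zero => exact fun _ => rfl
    | succ m ih =>
      intro hm
      rw [← apply_eq_apply_succ_of_differentiableAt (one_pos.trans hq) hm
        (h.differentiableAt_lorentzSum_add_smul ha hq _ _), ih]
  rw [heq i i.isLt, heq j j.isLt]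

end LorentzEmbedsInLq

section Cauchy

open Complex (I)
open ProbabilityTheory (cauchyPDF cauchyPDFReal cauchyMeasure cauchyMeasure_of_scale_ne_zero)
open scoped FourierTransform Real NNReal

theorem integrable_exp_neg_mul_abs {c : ℝ} (hc : 0 < c) :
    Integrable fun x : ℝ => Real.exp (-c * |x|) := by
  refine .of_integral_ne_zero ?_
  rw [integral_comp_abs (f := fun x => Real.exp (-c * x)), integral_exp_mul_Ioi (neg_lt_zero.2 hc)]
  simp [hc.ne']

theorem fourier_exp_neg_mul_abs {c : ℝ} (hc : 0 < c) (w : ℝ) :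
    𝓕 (fun x : ℝ => (Real.exp (-c * |x|) : ℂ)) w = (2 * c / (c ^ 2 + (2 * π * w) ^ 2) : ℝ) := by
  let z : ℂ := c + 2 * π * w * I
  let z' : ℂ := c - 2 * π * w * I
  have hz : z.re = c := by simp [z]
  have hz' : z'.re = c := by simp [z']
  have hz0 : z ≠ 0 := fun h => hc.ne' (by rw [← hz, h, Complex.zero_re])
  have hz0' : z' ≠ 0 := fun h => hc.ne' (by rw [← hz', h, Complex.zero_re])
  have hIoi : ∀ x ∈ Set.Ioi (0 : ℝ),
      Complex.exp (↑(-2 * π * x * w) * I) • (Real.exp (-c * |x|) : ℂ) = Complex.exp (-z * x) := by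
    intro x hx
    rw [abs_of_pos hx, smul_eq_mul, Complex.ofReal_exp, ← Complex.exp_add]
    congr 1
    simp only [z]
    push_cast
    ring
  have hIic : ∀ x ∈ Set.Iic (0 : ℝ),
      Complex.exp (↑(-2 * π * x * w) * I) • (Real.exp (-c * |x|) : ℂ) = Complex.exp (z' * x) := by
    intro x hx
    rw [abs_of_nonpos hx, smul_eq_mul, Complex.ofReal_exp, ← Complex.exp_add]
    congr 1
    simp only [z']
    push_cast
    ring
  have hzneg : (-z).re < 0 := by rwa [Complex.neg_re, hz, neg_lt_zero]
  rw [Real.fourier_real_eq_integral_exp_smul, ← intervalIntegral.integral_Iic_add_Ioi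
      ((integrableOn_exp_mul_complex_Iic (hc.trans_eq hz'.symm) 0).congr_fun
        (fun x hx => (hIic x hx).symm) measurableSet_Iic)
      ((integrableOn_exp_mul_complex_Ioi hzneg 0).congr_fun
        (fun x hx => (hIoi x hx).symm) measurableSet_Ioi),
    setIntegral_congr_fun measurableSet_Iic hIic, setIntegral_congr_fun measurableSet_Ioi hIoi,
    integral_exp_mul_complex_Iic (hc.trans_eq hz'.symm), integral_exp_mul_complex_Ioi hzneg]
  have hprod : z' * z = c ^ 2 + (2 * π * w) ^ 2 := by
    linear_combination (-(2 * π * w) ^ 2 : ℂ) * Complex.I_sq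
  simp only [Complex.ofReal_zero, mul_zero, Complex.exp_zero, neg_div_neg_eq]
  push_cast
  rw [one_div_add_one_div hz0' hz0, hprod]
  congr 1
  simp only [z, z']
  ring

theorem fourier_exp_neg_two_pi_mul_abs {γ : ℝ≥0} (hγ : γ ≠ 0) :
    𝓕 (fun x : ℝ => (Real.exp (-(2 * π * γ) * |x|) : ℂ)) =
      fun w => (cauchyPDFReal 0 γ w : ℂ) := by
  funext w
  rw [fourier_exp_neg_mul_abs (by positivity), ProbabilityTheory.cauchyPDFReal_def]
  congr 1
  field

theorem integral_cauchyMeasure {E : Type*} [NormedAddCommGroup E] [NormedSpace ℝ E] {γ : ℝ≥0}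
    (hγ : γ ≠ 0) (f : ℝ → E) :
    ∫ x, f x ∂cauchyMeasure 0 γ = ∫ x, cauchyPDFReal 0 γ x • f x := by
  rw [cauchyMeasure_of_scale_ne_zero 0 hγ, integral_withDensity_eq_integral_toReal_smul
    (ProbabilityTheory.measurable_cauchyPDF 0 γ) (by simp [ProbabilityTheory.cauchyPDF_def])]
  simp only [ProbabilityTheory.cauchyPDF_def,
    ENNReal.toReal_ofReal (ProbabilityTheory.cauchyPDF_pos 0 hγ _).le]

theorem charFun_cauchyMeasure (γ : ℝ≥0) (t : ℝ) :
    charFun (cauchyMeasure 0 γ) t = (Real.exp (-γ * |t|) : ℂ) := by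
  rcases eq_or_ne γ 0 with rfl | hγ
  · simp
  have hint : Integrable fun x : ℝ => (Real.exp (-(2 * π * γ) * |x|) : ℂ) :=
    (integrable_exp_neg_mul_abs (by positivity)).ofReal
  have hfourier : Integrable (𝓕 fun x : ℝ => (Real.exp (-(2 * π * γ) * |x|) : ℂ)) := by
    rw [fourier_exp_neg_two_pi_mul_abs hγ]
    exact (ProbabilityTheory.integrable_cauchyPDFReal 0).ofReal
  have hinv := hint.fourierInv_fourier_eq hfourier (v := t / (2 * π))
    (Continuous.continuousAt (by fun_prop))
  have hexp : -(2 * π * γ) * |t / (2 * π)| = -γ * |t| := by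
    rw [abs_div, abs_of_pos Real.two_pi_pos]
    field
  rw [fourier_exp_neg_two_pi_mul_abs hγ, Real.fourierInv_eq', hexp] at hinv
  rw [charFun_apply_real, integral_cauchyMeasure hγ, ← hinv]
  congr 1
  funext x
  rw [Complex.real_smul, smul_eq_mul, mul_comm]
  congr 3
  norm_cast
  simp only [RCLike.inner_apply, conj_trivial]
  field

theorem integrable_cauchyMeasure_iff {E : Type*} [NormedAddCommGroup E] [NormedSpace ℝ E] {γ : ℝ≥0}
    (hγ : γ ≠ 0) (f : ℝ → E) :
    Integrable f (cauchyMeasure 0 γ) ↔ Integrable fun x => cauchyPDFReal 0 γ x • f x := by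
  rw [cauchyMeasure_of_scale_ne_zero 0 hγ, integrable_withDensity_iff_integrable_smul'
    (ProbabilityTheory.measurable_cauchyPDF 0 γ) (by simp [ProbabilityTheory.cauchyPDF_def])]
  simp only [ProbabilityTheory.cauchyPDF_def,
    ENNReal.toReal_ofReal (ProbabilityTheory.cauchyPDF_pos 0 hγ _).le]

theorem cauchyPDFReal_mul_sq_le {γ : ℝ≥0} (hγ : γ ≠ 0) (x : ℝ) :
    cauchyPDFReal 0 γ x * (1 + |x|) ^ 2 ≤ π⁻¹ * γ * (2 * (1 + (γ ^ 2 : ℝ)⁻¹)) := by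
  have hpos : 0 < x ^ 2 + (γ : ℝ) ^ 2 := by positivity
  have hsq : (1 + |x|) ^ 2 ≤ 2 * (1 + (γ ^ 2 : ℝ)⁻¹) * (x ^ 2 + γ ^ 2) := calc
    (1 + |x|) ^ 2 ≤ 2 * (x ^ 2 + 1) := by nlinarith [sq_nonneg (1 - |x|), sq_abs x]
    _ ≤ 2 * (x ^ 2 + 1) + 2 * (γ ^ 2 + (γ ^ 2 : ℝ)⁻¹ * x ^ 2) :=
      le_add_of_nonneg_right (by positivity)
    _ = 2 * (1 + (γ ^ 2 : ℝ)⁻¹) * (x ^ 2 + γ ^ 2) := by field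
  rw [ProbabilityTheory.cauchyPDFReal_def, sub_zero, mul_assoc]
  exact mul_le_mul_of_nonneg_left ((inv_mul_le_iff₀' hpos).2 hsq) (by positivity)

theorem integrable_abs_rpow_cauchyMeasure (γ : ℝ≥0) {q : ℝ} (hq : 0 ≤ q) (hq1 : q < 1) :
    Integrable (fun x : ℝ => |x| ^ q) (cauchyMeasure 0 γ) := by
  rcases eq_or_ne γ 0 with rfl | hγ
  · simpa using integrable_dirac (by simp)
  rw [integrable_cauchyMeasure_iff hγ]
  have htail : Integrable fun x : ℝ => (1 + |x|) ^ (-(2 - q)) :=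
    integrable_one_add_norm (E := ℝ) (by rw [Module.finrank_self, Nat.cast_one]; linarith)
  refine (htail.const_mul (π⁻¹ * γ * (2 * (1 + (γ ^ 2 : ℝ)⁻¹)))).mono' (by fun_prop) (.of_forall
    fun x => ?_)
  have hpdf := (ProbabilityTheory.cauchyPDF_pos 0 hγ x).le
  have hx : 0 < 1 + |x| := by positivity
  rw [Real.norm_of_nonneg (smul_nonneg hpdf (by positivity)), smul_eq_mul]
  calc cauchyPDFReal 0 γ x * |x| ^ q ≤ cauchyPDFReal 0 γ x * (1 + |x|) ^ q := by
        gcongr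
        linarith
    _ = cauchyPDFReal 0 γ x * (1 + |x|) ^ 2 * (1 + |x|) ^ (-(2 - q)) := by
        rw [mul_assoc, ← Real.rpow_two, ← Real.rpow_add hx]
        congr 2
        ring
    _ ≤ _ := mul_le_mul_of_nonneg_right (cauchyPDFReal_mul_sq_le hγ x) (by positivity)

theorem integral_abs_rpow_cauchyMeasure_pos {γ : ℝ≥0} (hγ : γ ≠ 0) {q : ℝ} (hq : 0 < q)
    (hq1 : q < 1) : 0 < ∫ x : ℝ, |x| ^ q ∂cauchyMeasure 0 γ := by
  have hnonneg : 0 ≤ fun x : ℝ => |x| ^ q := fun x => Real.rpow_nonneg (abs_nonneg x) q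
  rw [integral_pos_iff_support_of_nonneg hnonneg (integrable_abs_rpow_cauchyMeasure γ hq.le hq1)]
  have hsupport : Function.support (fun x : ℝ => |x| ^ q) = {0}ᶜ := by
    ext x
    simp [hq.ne']
  have hzero : cauchyMeasure 0 γ {(0 : ℝ)} = 0 := by
    rw [cauchyMeasure_of_scale_ne_zero 0 hγ]
    exact withDensity_absolutelyContinuous _ _ (measure_singleton 0)
  rw [hsupport, prob_compl_eq_one_sub (measurableSet_singleton 0), hzero, tsub_zero]
  exact one_pos

theorem map_mul_add_mul_cauchyMeasure_prod (γ : ℝ≥0) (u v : ℝ) :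
    ((cauchyMeasure 0 γ).prod (cauchyMeasure 0 γ)).map (fun p => u * p.1 + v * p.2) =
      (cauchyMeasure 0 γ).map ((|u| + |v|) * ·) := by
  have hadd : ((cauchyMeasure 0 γ).prod (cauchyMeasure 0 γ)).map (fun p => u * p.1 + v * p.2) =
      (((cauchyMeasure 0 γ).map (u * ·)).prod ((cauchyMeasure 0 γ).map (v * ·))).map
        fun p => p.1 + p.2 := by
    rw [Measure.map_prod_map _ _ (by fun_prop) (by fun_prop),
      Measure.map_map (by fun_prop) (by fun_prop)]
    rfl
  have hu : IsProbabilityMeasure ((cauchyMeasure 0 γ).map (u * ·)) :=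
    Measure.isProbabilityMeasure_map (by fun_prop)
  have hv : IsProbabilityMeasure ((cauchyMeasure 0 γ).map (v * ·)) :=
    Measure.isProbabilityMeasure_map (by fun_prop)
  refine Measure.ext_of_charFun (funext fun t => ?_)
  rw [hadd, ProbabilityTheory.charFun_map_add_prod_eq_mul, Pi.mul_apply]
  simp only [charFun_map_mul, charFun_cauchyMeasure]
  rw [← Complex.ofReal_mul, ← Real.exp_add, abs_mul, abs_mul, abs_mul,
    abs_of_nonneg (add_nonneg (abs_nonneg u) (abs_nonneg v))]
  congr 2
  ring

theorem abs_abs_add_abs_mul_rpow (u v x q : ℝ) :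
    |(|u| + |v|) * x| ^ q = (|u| + |v|) ^ q * |x| ^ q := by
  have h : 0 ≤ |u| + |v| := add_nonneg (abs_nonneg u) (abs_nonneg v)
  rw [abs_mul, abs_of_nonneg h, Real.mul_rpow h (abs_nonneg x)]

theorem integrable_abs_rpow_cauchyMeasure_prod (γ : ℝ≥0) {q : ℝ} (hq : 0 ≤ q) (hq1 : q < 1)
    (u v : ℝ) : Integrable (fun p : ℝ × ℝ => |u * p.1 + v * p.2| ^ q)
      ((cauchyMeasure 0 γ).prod (cauchyMeasure 0 γ)) := by
  refine (integrable_map_measure (f := fun p : ℝ × ℝ => u * p.1 + v * p.2)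
    (g := fun y => |y| ^ q) (by fun_prop) (by fun_prop)).1 ?_
  rw [map_mul_add_mul_cauchyMeasure_prod, integrable_map_measure (by fun_prop) (by fun_prop)]
  simp only [Function.comp_def, abs_abs_add_abs_mul_rpow]
  exact (integrable_abs_rpow_cauchyMeasure γ hq hq1).const_mul _

theorem integral_abs_rpow_cauchyMeasure_prod (γ : ℝ≥0) (q u v : ℝ) :
    ∫ p : ℝ × ℝ, |u * p.1 + v * p.2| ^ q ∂(cauchyMeasure 0 γ).prod (cauchyMeasure 0 γ) =
      (|u| + |v|) ^ q * ∫ x, |x| ^ q ∂cauchyMeasure 0 γ := by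
  rw [← integral_map (φ := fun p : ℝ × ℝ => u * p.1 + v * p.2) (f := fun y => |y| ^ q)
    (by fun_prop) (Measurable.aestronglyMeasurable (by fun_prop)),
    map_mul_add_mul_cauchyMeasure_prod, integral_map (by fun_prop)
      (Measurable.aestronglyMeasurable (by fun_prop))]
  simp only [abs_abs_add_abs_mul_rpow, integral_const_mul]

end Cauchy

section LqRepresentable

open ProbabilityTheory (cauchyMeasure)

/-- The function `Φ` on `ℝ^ι` is an integral of `q`-th powers of absolute values of linear
functionals `x ↦ x ⬝ᵥ v` with respect to a finite measure in `v`. Such functions form a convex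
cone, and each of them is the `q`-th power of an `L_q` norm. -/
def IsLqRepresentable {ι : Type*} [Fintype ι] (q : ℝ) (Φ : (ι → ℝ) → ℝ) : Prop :=
  ∃ M : Measure (ι → ℝ), IsFiniteMeasure M ∧ ∀ x,
    Integrable (fun v => |x ⬝ᵥ v| ^ q) M ∧ ∫ v, |x ⬝ᵥ v| ^ q ∂M = Φ x

theorem half_abs_add_add_half_abs_sub (x y : ℝ) :
    |(x + y) / 2| + |(x - y) / 2| = max |x| |y| := by
  grind [abs_two]

variable {ι : Type*} [Fintype ι] {q : ℝ} {Φ Ψ : (ι → ℝ) → ℝ}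

theorem measurable_abs_dotProduct_rpow (q : ℝ) (x : ι → ℝ) :
    Measurable fun v => |x ⬝ᵥ v| ^ q := by
  unfold dotProduct
  fun_prop

namespace IsLqRepresentable

theorem zero : IsLqRepresentable q fun _ : ι → ℝ => 0 :=
  ⟨0, inferInstance, fun _ => ⟨integrable_zero_measure, integral_zero_measure _⟩⟩

theorem add (hΦ : IsLqRepresentable q Φ) (hΨ : IsLqRepresentable q Ψ) :
    IsLqRepresentable q fun x => Φ x + Ψ x := by
  obtain ⟨M, hM, h⟩ := hΦ
  obtain ⟨M', hM', h'⟩ := hΨ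
  refine ⟨M + M', inferInstance, fun x => ⟨(h x).1.add_measure (h' x).1, ?_⟩⟩
  rw [integral_add_measure (h x).1 (h' x).1, (h x).2, (h' x).2]

theorem const_mul (hΦ : IsLqRepresentable q Φ) {c : ℝ} (hc : 0 ≤ c) :
    IsLqRepresentable q fun x => c * Φ x := by
  obtain ⟨M, hM, h⟩ := hΦ
  refine ⟨c.toNNReal • M, inferInstance, fun x => ⟨(h x).1.smul_measure_nnreal, ?_⟩⟩
  rw [integral_smul_nnreal_measure, (h x).2, NNReal.smul_def, Real.coe_toNNReal _ hc, smul_eq_mul]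

theorem sum {κ : Type*} (s : Finset κ) {Φ : κ → (ι → ℝ) → ℝ}
    (h : ∀ i ∈ s, IsLqRepresentable q (Φ i)) : IsLqRepresentable q fun x => ∑ i ∈ s, Φ i x := by
  rw [← Finset.sum_fn]
  exact Finset.sum_induction Φ _ (fun _ _ => add) zero h

theorem abs_dotProduct_rpow (q : ℝ) (w : ι → ℝ) : IsLqRepresentable q fun x => |x ⬝ᵥ w| ^ q :=
  ⟨Measure.dirac w, inferInstance, fun x =>
    ⟨integrable_dirac' (measurable_abs_dotProduct_rpow q x).stronglyMeasurable (by simp),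
      integral_dirac' _ _ (measurable_abs_dotProduct_rpow q x).stronglyMeasurable⟩⟩

theorem abs_apply_rpow (q : ℝ) (i : ι) : IsLqRepresentable q fun x => |x i| ^ q := by
  classical
  simpa only [dotProduct_single_one] using abs_dotProduct_rpow q (Pi.single i 1)

theorem abs_dotProduct_add_abs_dotProduct_rpow_of_lt_one (hq : 0 < q) (hq1 : q < 1)
    (v w : ι → ℝ) : IsLqRepresentable q fun x => (|x ⬝ᵥ v| + |x ⬝ᵥ w|) ^ q := by
  have hpos := integral_abs_rpow_cauchyMeasure_pos one_ne_zero hq hq1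
  have hmeas : Measurable fun p : ℝ × ℝ => p.1 • v + p.2 • w := by fun_prop
  have hdot : ∀ (x : ι → ℝ) (p : ℝ × ℝ),
      x ⬝ᵥ (p.1 • v + p.2 • w) = x ⬝ᵥ v * p.1 + x ⬝ᵥ w * p.2 := fun x p => by
    simp only [dotProduct_add, dotProduct_smul, smul_eq_mul, mul_comm]
  have hrep : IsLqRepresentable q fun x =>
      (∫ y, |y| ^ q ∂cauchyMeasure 0 1) * (|x ⬝ᵥ v| + |x ⬝ᵥ w|) ^ q := by
    refine ⟨((cauchyMeasure 0 1).prod (cauchyMeasure 0 1)).map fun p => p.1 • v + p.2 • w,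
      inferInstance, fun x => ⟨?_, ?_⟩⟩
    · rw [integrable_map_measure (measurable_abs_dotProduct_rpow q x).aestronglyMeasurable
        hmeas.aemeasurable]
      simpa only [Function.comp_def, hdot] using
        integrable_abs_rpow_cauchyMeasure_prod 1 hq.le hq1 _ _
    · rw [integral_map hmeas.aemeasurable
        (measurable_abs_dotProduct_rpow q x).aestronglyMeasurable]
      simp only [hdot, integral_abs_rpow_cauchyMeasure_prod]
      exact mul_comm _ _
  simpa only [inv_mul_cancel_left₀ hpos.ne'] using hrep.const_mul (inv_nonneg.2 hpos.le)

theorem abs_dotProduct_add_abs_dotProduct_rpow (hq : 0 < q) (hq1 : q ≤ 1) (v w : ι → ℝ) :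
    IsLqRepresentable q fun x => (|x ⬝ᵥ v| + |x ⬝ᵥ w|) ^ q := by
  rcases hq1.lt_or_eq with hq1 | rfl
  · exact abs_dotProduct_add_abs_dotProduct_rpow_of_lt_one hq hq1 v w
  · simpa only [Real.rpow_one] using (abs_dotProduct_rpow 1 v).add (abs_dotProduct_rpow 1 w)

theorem max_rpow (hq : 0 < q) (hq1 : q ≤ 1) (i j : ι) :
    IsLqRepresentable q fun x => max |x i| |x j| ^ q := by
  classical
  have h := abs_dotProduct_add_abs_dotProduct_rpow hq hq1
    ((1 / 2 : ℝ) • (Pi.single i 1 + Pi.single j 1 : ι → ℝ))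
    ((1 / 2 : ℝ) • (Pi.single i 1 - Pi.single j 1 : ι → ℝ))
  simpa only [dotProduct_smul, dotProduct_add, dotProduct_sub, dotProduct_single_one, smul_eq_mul,
    one_div, inv_mul_eq_div, half_abs_add_add_half_abs_sub] using h

theorem exists_isProbabilityMeasure (hq : 0 < q) (hΦ : IsLqRepresentable q Φ) :
    ∃ P : Measure (ι → ℝ), IsProbabilityMeasure P ∧ ∀ x,
      Integrable (fun v => |x ⬝ᵥ v| ^ q) P ∧ ∫ v, |x ⬝ᵥ v| ^ q ∂P = Φ x := by
  obtain ⟨M, hM, h⟩ := hΦ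
  rcases eq_or_ne M 0 with rfl | hM0
  · refine ⟨Measure.dirac 0, inferInstance, fun x => ⟨integrable_dirac (by simp), ?_⟩⟩
    rw [← (h x).2]
    simp [Real.zero_rpow hq.ne']
  have : NeZero M := ⟨hM0⟩
  set m : ℝ := M.real Set.univ
  have hm : 0 < m := measureReal_univ_pos
  have hscale : ∀ x v : ι → ℝ, |x ⬝ᵥ (m ^ q⁻¹ • v)| ^ q = m * |x ⬝ᵥ v| ^ q := fun x v => by
    rw [dotProduct_smul, smul_eq_mul, abs_mul, abs_of_pos (Real.rpow_pos_of_pos hm _),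
      Real.mul_rpow (Real.rpow_nonneg hm.le _) (abs_nonneg _), Real.rpow_inv_rpow hm.le hq.ne']
  have hmeas : Measurable fun v : ι → ℝ => m ^ q⁻¹ • v := by fun_prop
  refine ⟨((M Set.univ)⁻¹ • M).map fun v => m ^ q⁻¹ • v,
    Measure.isProbabilityMeasure_map hmeas.aemeasurable, fun x => ⟨?_, ?_⟩⟩
  · rw [integrable_map_measure (measurable_abs_dotProduct_rpow q x).aestronglyMeasurable
      hmeas.aemeasurable]
    simp only [Function.comp_def, hscale]
    exact ((h x).1.smul_measure (by simpa using hM0)).const_mul m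
  · rw [integral_map hmeas.aemeasurable (measurable_abs_dotProduct_rpow q x).aestronglyMeasurable]
    simp only [hscale]
    rw [integral_const_mul, integral_smul_measure, (h x).2, ENNReal.toReal_inv, smul_eq_mul]
    exact mul_inv_cancel_left₀ hm.ne' _

end IsLqRepresentable

theorem exists_measurable_map_volume_Ioo_eq {Y : Type*} [Nonempty Y] [MeasurableSpace Y]
    [StandardBorelSpace Y] (P : Measure Y) [IsProbabilityMeasure P] :
    ∃ F : ℝ → Y, Measurable F ∧ (volume.restrict (Set.Ioo (0 : ℝ) 1)).map F = P := by
  obtain ⟨f, hf, hfP⟩ := P.exists_measurable_map_eq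
  have hproj : Measurable (Set.projIcc (0 : ℝ) 1 zero_le_one) := continuous_projIcc.measurable
  refine ⟨f ∘ Set.projIcc 0 1 zero_le_one, hf.comp hproj, ?_⟩
  rw [Measure.restrict_congr_set Ioo_ae_eq_Icc, ← unitInterval.measurePreserving_coe.map_eq,
    Measure.map_map (hf.comp hproj) measurable_subtype_coe, ← hfP]
  congr 1
  ext t : 1
  rw [Function.comp_apply, Function.comp_apply, Set.projIcc_val]

theorem exists_linearMap_norm_rpow_eq_integral (hq : 0 < q) {Ω : Type*} [MeasurableSpace Ω]
    {μ : Measure Ω} {F : Ω → ι → ℝ} (hF : Measurable F)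
    (hint : ∀ x, Integrable (fun ω => |x ⬝ᵥ F ω| ^ q) μ) :
    ∃ T : (ι → ℝ) →ₗ[ℝ] Lp ℝ (ENNReal.ofReal q) μ, ∀ x, ‖T x‖ ^ q = ∫ ω, |x ⬝ᵥ F ω| ^ q ∂μ := by
  classical
  have hmem : ∀ i, MemLp (fun ω => F ω i) (ENNReal.ofReal q) μ := fun i => by
    rw [← integrable_norm_rpow_iff (by fun_prop) (by simpa using hq) ENNReal.ofReal_ne_top]
    simpa only [ENNReal.toReal_ofReal hq.le, Real.norm_eq_abs, single_one_dotProduct] using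
      hint (Pi.single i 1)
  refine ⟨Fintype.linearCombination ℝ fun i => (hmem i).toLp _, fun x => ?_⟩
  rw [norm_rpow_Lp hq, Fintype.linearCombination_apply]
  refine integral_congr_ae ?_
  have hcoord : ∀ᵐ ω ∂μ, ∀ i, (x i • (hmem i).toLp _ : Lp ℝ (ENNReal.ofReal q) μ) ω =
      x i * F ω i := ae_all_iff.2 fun i => by
    filter_upwards [Lp.coeFn_smul (x i) ((hmem i).toLp _), (hmem i).coeFn_toLp] with ω hsmul hcoe
    rw [hsmul, Pi.smul_apply, hcoe, smul_eq_mul]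
  filter_upwards [hcoord, Lp.coeFn_fun_finsetSum Finset.univ
    fun i => x i • (hmem i).toLp fun ω => F ω i] with ω hω hsum
  simp only [hsum, hω, dotProduct]

theorem IsLqRepresentable.exists_linearMap_norm_rpow_eq (hq : 0 < q)
    (hΦ : IsLqRepresentable q Φ) :
    ∃ T : (ι → ℝ) →ₗ[ℝ] Lp ℝ (ENNReal.ofReal q) (volume.restrict (Set.Ioo (0 : ℝ) 1)),
      ∀ x, ‖T x‖ ^ q = Φ x := by
  obtain ⟨P, hP, h⟩ := hΦ.exists_isProbabilityMeasure hq
  obtain ⟨F, hF, rfl⟩ := exists_measurable_map_volume_Ioo_eq P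
  obtain ⟨T, hT⟩ := exists_linearMap_norm_rpow_eq_integral hq hF fun x =>
    (integrable_map_measure (measurable_abs_dotProduct_rpow q x).aestronglyMeasurable
      hF.aemeasurable).1 (h x).1
  refine ⟨T, fun x => ?_⟩
  rw [hT, ← (h x).2, integral_map hF.aemeasurable
    (measurable_abs_dotProduct_rpow q x).aestronglyMeasurable]

end LqRepresentable

theorem IsLqRepresentable.lorentzEmbedsInLq {n : ℕ} {a : Fin n → ℝ} {q : ℝ} (hq : 0 < q)
    (h : IsLqRepresentable q (lorentzSum a q)) :
    LorentzEmbedsInLq a q (volume.restrict (Set.Ioo (0 : ℝ) 1)) := by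
  obtain ⟨T, hT⟩ := h.exists_linearMap_norm_rpow_eq hq
  refine ⟨T, fun x => ?_⟩
  change ‖T x‖ = lorentzSum a q x ^ (1 / q)
  have hnonneg : 0 ≤ ‖T x‖ := by
    rw [Lp.norm_def]
    exact ENNReal.toReal_nonneg
  rw [← hT, one_div, Real.rpow_rpow_inv hnonneg hq.ne']

section Sufficiency

variable {n : ℕ} {a : Fin n → ℝ} {q : ℝ}

theorem lorentzEmbedsInLq_const {c : ℝ} (hc : 0 ≤ c) (hq : 0 < q) :
    LorentzEmbedsInLq (fun _ : Fin n => c) q (volume.restrict (Set.Ioo (0 : ℝ) 1)) := by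
  refine IsLqRepresentable.lorentzEmbedsInLq hq ?_
  rw [funext fun x => lorentzSum_const c q x]
  exact .const_mul (.sum _ fun i _ => .abs_apply_rpow q i) hc

theorem EqualDifferences.eq_add_mul (h : EqualDifferences a) (hn : 1 < n) :
    a = fun k : Fin n => a ⟨n - 1, by omega⟩ +
      (a ⟨0, by omega⟩ - a ⟨1, hn⟩) * ((n : ℝ) - 1 - k) := by
  have hlin : ∀ (m : ℕ) (hm : m < n), a ⟨m, hm⟩ =
      a ⟨0, by omega⟩ - (a ⟨0, by omega⟩ - a ⟨1, hn⟩) * m := by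
    intro m
    induction m with
    | zero => simp
    | succ m ih =>
      intro hm
      have hstep := h m 0 hm hn
      rw [ih (Nat.lt_of_succ_lt hm)] at hstep
      push_cast
      linear_combination -hstep
  funext k
  rw [hlin k k.isLt, hlin (n - 1) (by omega), Nat.cast_pred (by omega)]
  ring

theorem EqualDifferences.lorentzEmbedsInLq (h : EqualDifferences a) (hn : 1 < n)
    (ha_anti : Antitone a) (ha : ∀ i, 0 ≤ a i) (hq : 0 < q) (hq1 : q ≤ 1) :
    LorentzEmbedsInLq a q (volume.restrict (Set.Ioo (0 : ℝ) 1)) := by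
  have hdiff := sub_nonneg.2 (ha_anti (Fin.mk_le_mk.2 zero_le_one) : a ⟨1, hn⟩ ≤ a ⟨0, by omega⟩)
  refine IsLqRepresentable.lorentzEmbedsInLq hq ?_
  rw [h.eq_add_mul hn, funext (lorentzSum_eq_sum_max q (a ⟨n - 1, by omega⟩)
    (a ⟨0, by omega⟩ - a ⟨1, hn⟩))]
  refine .add (.sum _ fun i _ => .sum _ fun j _ => ?_)
    (.sum _ fun i _ => (IsLqRepresentable.abs_apply_rpow q i).const_mul (ha _))
  split_ifs
  · exact (IsLqRepresentable.max_rpow hq hq1 i j).const_mul (div_nonneg hdiff zero_le_two)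
  · exact .zero

theorem lorentzNorm_const {c : ℝ} (hc : 0 ≤ c) (hq : 0 < q) (x : Fin n → ℝ) :
    lorentzNorm (fun _ => c) q x = c ^ (1 / q) * ‖WithLp.toLp (ENNReal.ofReal q) x‖ := by
  change lorentzSum (fun _ => c) q x ^ (1 / q) = _
  rw [lorentzSum_const, Real.mul_rpow hc (Finset.sum_nonneg fun i _ => by positivity),
    PiLp.norm_eq_sum (by rwa [ENNReal.toReal_ofReal hq.le]), ENNReal.toReal_ofReal hq.le]
  simp only [Real.norm_eq_abs]

theorem equalDifferences_of_eq_two (hn : n = 2) : EqualDifferences a := fun i j hi hj => by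
  obtain rfl : i = j := by omega
  rfl

end Sufficiency

theorem theorem1_general {n : ℕ} (hn : 2 ≤ n) (a : Fin n → ℝ) (ha_nonneg : ∀ i, 0 ≤ a i) (q : ℝ)
    (hq : 0 < q) :
    (q ≤ 1 →
      (LorentzEmbedsInLq a q (volume.restrict (Set.Ioo (0 : ℝ) 1)) ↔
        Antitone a ∧ EqualDifferences a) ∧
      (∀ {Ω : Type*} [MeasurableSpace Ω] (μ : Measure Ω),
        LorentzEmbedsInLq a q μ → Antitone a ∧ EqualDifferences a) ∧
      (n = 2 → Antitone a → LorentzEmbedsInLq a q (volume.restrict (Set.Ioo (0 : ℝ) 1)))) ∧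
    (1 < q →
      (LorentzEmbedsInLq a q (volume.restrict (Set.Ioo (0 : ℝ) 1)) ↔ ∀ i j, a i = a j) ∧
      (∀ {Ω : Type*} [MeasurableSpace Ω] (μ : Measure Ω),
        LorentzEmbedsInLq a q μ → ∀ i j, a i = a j) ∧
      (∀ c : ℝ, (∀ i, a i = c) → ∀ x : Fin n → ℝ,
        lorentzNorm a q x = c ^ (1 / q) * ‖WithLp.toLp (ENNReal.ofReal q) x‖)) := by
  refine ⟨fun hq1 => ?_, fun hq1 => ?_⟩
  · have hq2 : q < 2 := hq1.trans_lt one_lt_two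
    exact ⟨⟨fun h => h.antitone_and_equalDifferences ha_nonneg hq hq2,
        fun h => h.2.lorentzEmbedsInLq hn h.1 ha_nonneg hq hq1⟩,
      fun μ h => h.antitone_and_equalDifferences ha_nonneg hq hq2,
      fun hn2 h => (equalDifferences_of_eq_two hn2).lorentzEmbedsInLq hn h ha_nonneg hq hq1⟩
  · have hc : ∀ c, (∀ i, a i = c) → a = (fun _ => c) ∧ 0 ≤ c := fun c hc =>
      ⟨funext hc, hc ⟨0, by omega⟩ ▸ ha_nonneg _⟩
    refine ⟨⟨fun h => h.eq_of_one_lt ha_nonneg hq1, fun h => ?_⟩,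
      fun μ h => h.eq_of_one_lt ha_nonneg hq1, fun c h x => ?_⟩
    · obtain ⟨heq, hnonneg⟩ := hc (a ⟨0, by omega⟩) fun i => h i _
      rw [heq]
      exact lorentzEmbedsInLq_const hnonneg hq
    · obtain ⟨rfl, hnonneg⟩ := hc c h
      exact lorentzNorm_const hnonneg hq x

theorem theorem1 {n : ℕ} (hn : 2 ≤ n) (a : Fin n → ℝ) (ha_anti : Antitone a)
    (ha_nonneg : ∀ i, 0 ≤ a i) (ha_ne : ∃ i, a i ≠ 0) (q : ℝ) (hq : 0 < q) :
    (q ≤ 1 →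
      (LorentzEmbedsInLq a q (volume.restrict (Set.Ioo (0 : ℝ) 1)) ↔ EqualDifferences a) ∧
      (∀ {Ω : Type*} [MeasurableSpace Ω] (μ : Measure Ω),
        LorentzEmbedsInLq a q μ → EqualDifferences a) ∧
      (n = 2 → LorentzEmbedsInLq a q (volume.restrict (Set.Ioo (0 : ℝ) 1)))) ∧
    (1 < q →
      (LorentzEmbedsInLq a q (volume.restrict (Set.Ioo (0 : ℝ) 1)) ↔ ∀ i j, a i = a j) ∧
      (∀ {Ω : Type*} [MeasurableSpace Ω] (μ : Measure Ω),
        LorentzEmbedsInLq a q μ → ∀ i j, a i = a j) ∧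
      (∀ c : ℝ, (∀ i, a i = c) → ∀ x : Fin n → ℝ,
        lorentzNorm a q x = c ^ (1 / q) * ‖WithLp.toLp (ENNReal.ofReal q) x‖)) := by
  simpa only [ha_anti, true_and, forall_const] using theorem1_general hn a ha_nonneg q hq
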